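/- Let $A\in\mathbb{R}^{m\times n}$ have rank $\rho$, and let $A=U\Sigma V^\top$ be a compact singular value decomposition ($U\in\mathbb{R}^{m\times\rho}$ and $V\in\mathbb{R}^{n\times\rho}$ have orthonormal columns, and $\Sigma$ is the diagonal matrix of the positive singular values of $A$ in descending order). Let $1\le k<\rho$, let $V_1\in\mathbb{R}^{n\times k}$ consist of the first $k$ columns of $V$, let $\mathbf v_i\in\mathbb{R}^k$ be the $i$-th column of $V_1^\top$, and let $s_i^*=\|\mathbf v_i\|_2^2$ for $1\le i\le n$. Let $\mathbf s=(s_1,\dots,s_n)$ be scores with $s_i\ge 0$, $\sum_{i=1}^n s_i=k$, and $s_i>0$ whenever $s_i^*>0$, and put $$c(\mathbf s)=\max_{1\le i\le n}\frac{s_i^*}{s_i}\qquad(\text{with } 0/0:=0).$$ Let $i_1,\dots,i_\ell$ be independent random indices in $\{1,\dots,n\}$, each with $\Pr[i_j=i]=s_i/\sum_{a=1}^n s_a$. Let $S\in\mathbb{R}^{n\times\ell}$ be the sampling matrix with $S_{ij}=1$ if $i=i_j$ and $S_{ij}=0$ otherwise, let $D\in\mathbb{R}^{\ell\times\ell}$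 be the diagonal matrix with $D_{jj}=1/\sqrt{s_{i_j}}$ (with probability one all $s_{i_j}$ are positive), and let $\Omega_1=V_1^\top SD\in\mathbb{R}^{k\times\ell}$. Theorem. For every real $\delta\ge 0$, with probability at least $1-k\exp\left(-\dfrac{\delta^2\ell}{2k\,c(\mathbf s)}\right)$, $$\lambda_{\min}(\Omega_1\Omega_1^\top)\ \ge\ (1-\delta)\frac{\ell}{k},$$ where $\lambda_{\min}$ denotes the smallest eigenvalue. -/

import Mathlib

open MeasureTheory ProbabilityTheory
open scoped Matrix

namespace ColumnSampling

noncomputable section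

/-- `A = U Σ Vᵀ` is a (compact) singular value decomposition of `A`: with `ρ` the rank of `A`, the
`ρ` columns of `U` and those of `V` are orthonormal and `Σ` is the diagonal matrix of the positive
singular values `σ` in descending order. -/
structure IsSVD {m n : ℕ} (A : Matrix (Fin m) (Fin n) ℝ)
    (U : Matrix (Fin m) (Fin A.rank) ℝ) (σ : Fin A.rank → ℝ)
    (V : Matrix (Fin n) (Fin A.rank) ℝ) : Prop where
  left_orthonormal : Uᵀ * U = 1
  right_orthonormal : Vᵀ * V = 1
  pos : ∀ a, 0 < σ a
  antitone : Antitone σ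
  eq_mul : A = U * Matrix.diagonal σ * Vᵀ

/-- The first `k` columns of `V`; for the right factor of an SVD this is `V₁`. -/
def firstColumns {n ρ k : ℕ} (V : Matrix (Fin n) (Fin ρ) ℝ) (h : k ≤ ρ) :
    Matrix (Fin n) (Fin k) ℝ :=
  V.submatrix id (Fin.castLE h)

/-- The leverage score `s*_i = ‖v_i‖₂²`, where `v_i` is the `i`-th row of `V₁` (that is, the `i`-th
column of `V₁ᵀ`). -/
def leverage {n k : ℕ} (V₁ : Matrix (Fin n) (Fin k) ℝ) (i : Fin n) : ℝ :=
  ‖(WithLp.toLp 2 (V₁ i) : EuclideanSpace ℝ (Fin k))‖ ^ 2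

/-- `c(s) = max_i s*_i / s_i`. A term `0 / 0` counts as `0`; the scores considered have `s_i > 0`
whenever `s*_i > 0`. -/
def scoreRatio {n k : ℕ} (V₁ : Matrix (Fin n) (Fin k) ℝ) (s : Fin n → ℝ) : ℝ :=
  ⨆ i : Fin n, leverage V₁ i / s i

/-- The sampling matrix `S` of the sampled indices `i_1, …, i_ℓ`. -/
def samplingMatrix {n ℓ : ℕ} (i : Fin ℓ → Fin n) : Matrix (Fin n) (Fin ℓ) ℝ :=
  Matrix.of fun a j => if a = i j then 1 else 0

/-- The diagonal rescaling matrix `D`, with `D_jj = 1 / √s_{i_j}`. -/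
def rescalingMatrix {n ℓ : ℕ} (s : Fin n → ℝ) (i : Fin ℓ → Fin n) :
    Matrix (Fin ℓ) (Fin ℓ) ℝ :=
  Matrix.diagonal fun j => 1 / √(s (i j))

/-- `Ω₁ = V₁ᵀ S D`. -/
def sampledTop {n k ℓ : ℕ} (V₁ : Matrix (Fin n) (Fin k) ℝ) (s : Fin n → ℝ)
    (i : Fin ℓ → Fin n) : Matrix (Fin k) (Fin ℓ) ℝ :=
  V₁ᵀ * (samplingMatrix i * rescalingMatrix s i)

/-- The smallest eigenvalue of a symmetric real matrix of size at least one (whose spectrum is a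
nonempty finite set of real numbers). -/
def lambdaMin {k : ℕ} (M : Matrix (Fin k) (Fin k) ℝ) : ℝ :=
  sInf (spectrum ℝ M)

end

end ColumnSampling

/-!
`Ω₁ Ω₁ᵀ` is a sum of `ℓ` independent copies of `x xᵀ`, where `x = vᵢ / √sᵢ` with probability
`sᵢ / k`. The weights cancel, so `E x xᵀ = V₁ᵀ V₁ / k = 1 / k`, while `‖x‖² ≤ R = c(s)`. The claim is
the lower matrix Chernoff bound for such a sum, whose smallest expected eigenvalue is `ℓ / k`.

The bound follows from Markov's inequality for `tr exp (c - t Ω₁ Ω₁ᵀ)`, which dominates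
`exp (c - t μ)` for each eigenvalue `μ` of `Ω₁ Ω₁ᵀ`. Since the mean of `x xᵀ` is a multiple of the
identity, the only noncommutative input is the rank-one inequality `trace_exp_sub_le`,
`tr exp (K - t x xᵀ) ≤ tr exp K - (1 - e ^ (-R t)) / R * (x ⬝ exp K x)`.
Averaged over `x`, it shows that each sample multiplies the expected potential by at most
`1 - (1 - e ^ (-R t)) / (R k)`, hence by at most the exponential of `-(1 - e ^ (-R t)) / (R k)`; see
`sum_mul_trace_exp_sub_le`. With `t = δ / R` and
`e ^ (-δ) ≤ 1 - δ + δ² / 2`, the product over `ℓ` samples is the required exponential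
(`sum_prod_filter_spectrum_lt_le`).

For the rank-one inequality put `K_τ = K - τ x xᵀ`, positive semidefinite for `0 ≤ τ ≤ t`. The
derivative of `tr exp K_τ` is `-h(τ)` with `h(τ) = x ⬝ exp K_τ x`. Expanding in powers, `-h'` is a
combination of products of moments `(x ⬝ K_τ ^ i x) (x ⬝ K_τ ^ j x)`, and Chebyshev's association
inequality bounds each one by `R (x ⬝ K_τ ^ (i + j) x)` (`quadratic_pow_mul_le`), so `h' ≥ -R h` and
`h(τ) ≥ e ^ (-R τ) h(0)`. Integration gives the claim. All differentiation takes place in partial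
sums of the exponential series, which are polynomial in `τ`; the limit is taken at the end.
-/

namespace ColumnSampling

/-! ### Rank-one perturbations of the trace exponential -/

section RankOne

open scoped Matrix.Norms.Operator Nat

variable {ι : Type*} [Fintype ι] [DecidableEq ι]

theorem pow_eq_conj_diagonal {K : Matrix ι ι ℝ} (hK : K.IsHermitian) (n : ℕ) :
    K ^ n = (hK.eigenvectorUnitary : Matrix ι ι ℝ) *
      Matrix.diagonal (fun a => hK.eigenvalues a ^ n) *
      (hK.eigenvectorUnitary : Matrix ι ι ℝ)ᵀ := by
  conv_lhs => rw [hK.spectral_theorem]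
  rw [← map_pow, Unitary.conjStarAlgAut_apply, Matrix.diagonal_pow]
  rfl

theorem trace_pow_eq_sum_eigenvalues {K : Matrix ι ι ℝ} (hK : K.IsHermitian) (n : ℕ) :
    (K ^ n).trace = ∑ a, hK.eigenvalues a ^ n := by
  have hU : (hK.eigenvectorUnitary : Matrix ι ι ℝ)ᵀ * hK.eigenvectorUnitary = 1 :=
    Unitary.coe_star_mul_self hK.eigenvectorUnitary
  rw [pow_eq_conj_diagonal hK, Matrix.trace_mul_comm, ← Matrix.mul_assoc, hU, Matrix.one_mul,
    Matrix.trace_diagonal]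

theorem quadratic_pow_eq_sum {K : Matrix ι ι ℝ} (hK : K.IsHermitian) (x : ι → ℝ) (n : ℕ) :
    x ⬝ᵥ (K ^ n *ᵥ x) = ∑ a, hK.eigenvalues a ^ n *
      ((hK.eigenvectorUnitary : Matrix ι ι ℝ)ᵀ *ᵥ x) a ^ 2 := by
  rw [pow_eq_conj_diagonal hK, ← Matrix.mulVec_mulVec, ← Matrix.mulVec_mulVec,
    Matrix.dotProduct_mulVec, ← Matrix.mulVec_transpose]
  simp only [dotProduct, Matrix.mulVec_diagonal]
  exact Finset.sum_congr rfl fun a _ => by ring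

theorem quadratic_pow_nonneg {K : Matrix ι ι ℝ} (hK : K.PosSemidef) (x : ι → ℝ) (n : ℕ) :
    0 ≤ x ⬝ᵥ (K ^ n *ᵥ x) := by
  rw [quadratic_pow_eq_sum hK.1]
  exact Finset.sum_nonneg fun a _ =>
    mul_nonneg (pow_nonneg (hK.eigenvalues_nonneg a) n) (sq_nonneg _)

/-- Chebyshev's association inequality for the powers `l ^ i` and `l ^ j`. -/
theorem sum_pow_mul_sum_pow_le {ι : Type*} [Fintype ι] {l w : ι → ℝ} (hl : ∀ a, 0 ≤ l a)
    (hw : ∀ a, 0 ≤ w a) (i j : ℕ) :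
    (∑ a, l a ^ i * w a) * (∑ a, l a ^ j * w a) ≤ (∑ a, w a) * ∑ a, l a ^ (i + j) * w a := by
  have key : 0 ≤ ∑ a, ∑ b, w a * w b * ((l a ^ i - l b ^ i) * (l a ^ j - l b ^ j)) := by
    refine Finset.sum_nonneg fun a _ => Finset.sum_nonneg fun b _ =>
      mul_nonneg (mul_nonneg (hw a) (hw b)) ?_
    rcases le_total (l a) (l b) with h | h
    · exact mul_nonneg_of_nonpos_of_nonpos (sub_nonpos.2 (pow_le_pow_left₀ (hl a) h i))
        (sub_nonpos.2 (pow_le_pow_left₀ (hl a) h j))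
    · exact mul_nonneg (sub_nonneg.2 (pow_le_pow_left₀ (hl b) h i))
        (sub_nonneg.2 (pow_le_pow_left₀ (hl b) h j))
  have expand : ∑ a, ∑ b, w a * w b * ((l a ^ i - l b ^ i) * (l a ^ j - l b ^ j)) =
      (∑ a, l a ^ (i + j) * w a) * (∑ b, w b) + (∑ a, w a) * (∑ b, l b ^ (i + j) * w b)
        - (∑ a, l a ^ i * w a) * (∑ b, l b ^ j * w b)
        - (∑ a, l a ^ j * w a) * (∑ b, l b ^ i * w b) := by
    simp only [Finset.sum_mul_sum, ← Finset.sum_add_distrib, ← Finset.sum_sub_distrib]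
    exact Finset.sum_congr rfl fun a _ => Finset.sum_congr rfl fun b _ => by ring
  linarith

/-- The moments `x ⬝ Kⁿ x` are those of a positive measure on the spectrum of `K ≥ 0`, of mass
`x ⬝ x`,
so Chebyshev's association inequality applies. -/
theorem quadratic_pow_mul_le {K : Matrix ι ι ℝ} (hK : K.PosSemidef) (x : ι → ℝ) (i j : ℕ) :
    (x ⬝ᵥ (K ^ i *ᵥ x)) * (x ⬝ᵥ (K ^ j *ᵥ x)) ≤ (x ⬝ᵥ x) * (x ⬝ᵥ (K ^ (i + j) *ᵥ x)) := by
  have h0 := quadratic_pow_eq_sum hK.1 x 0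
  simp only [pow_zero, Matrix.one_mulVec, one_mul] at h0
  rw [h0, quadratic_pow_eq_sum hK.1, quadratic_pow_eq_sum hK.1, quadratic_pow_eq_sum hK.1]
  exact sum_pow_mul_sum_pow_le hK.eigenvalues_nonneg (fun a => sq_nonneg _) i j

theorem hasDerivAt_sub_smul_pow (K : Matrix ι ι ℝ) (x : ι → ℝ) (n : ℕ) (τ : ℝ) :
    HasDerivAt (fun τ : ℝ => (K - τ • Matrix.vecMulVec x x) ^ n)
      (-∑ i ∈ Finset.range n, (K - τ • Matrix.vecMulVec x x) ^ (n - 1 - i) *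
        Matrix.vecMulVec x x * (K - τ • Matrix.vecMulVec x x) ^ i) τ := by
  have h1 : HasDerivAt (fun τ : ℝ => K - τ • Matrix.vecMulVec x x)
      (-Matrix.vecMulVec x x) τ := by
    exact (((hasDerivAt_id τ).smul_const (Matrix.vecMulVec x x)).const_sub K).congr_deriv
      (by rw [one_smul])
  refine (h1.fun_pow' n).congr_deriv ?_
  simp only [Nat.pred_eq_sub_one, mul_neg, neg_mul, Finset.sum_neg_distrib]

theorem hasDerivAt_quadratic_pow (K : Matrix ι ι ℝ) (x : ι → ℝ) (n : ℕ) (τ : ℝ) :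
    HasDerivAt (fun τ : ℝ => x ⬝ᵥ ((K - τ • Matrix.vecMulVec x x) ^ n *ᵥ x))
      (-∑ i ∈ Finset.range n, (x ⬝ᵥ ((K - τ • Matrix.vecMulVec x x) ^ (n - 1 - i) *ᵥ x)) *
        (x ⬝ᵥ ((K - τ • Matrix.vecMulVec x x) ^ i *ᵥ x))) τ := by
  let q : Matrix ι ι ℝ →ₗ[ℝ] ℝ :=
    { toFun := fun M => x ⬝ᵥ (M *ᵥ x)
      map_add' := fun M N => by rw [Matrix.add_mulVec, dotProduct_add]
      map_smul' := fun c M => by rw [Matrix.smul_mulVec, dotProduct_smul]; rfl }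
  refine ((LinearMap.toContinuousLinearMap q).hasFDerivAt.comp_hasDerivAt τ
    (hasDerivAt_sub_smul_pow K x n τ)).congr_deriv ?_
  change q _ = _
  rw [map_neg, map_sum]
  refine congrArg Neg.neg (Finset.sum_congr rfl fun i _ => ?_)
  change x ⬝ᵥ ((_ * _ * _) *ᵥ x) = _
  rw [← Matrix.mulVec_mulVec, ← Matrix.mulVec_mulVec, Matrix.vecMulVec_mulVec]
  simp [Matrix.mulVec_smul, dotProduct_smul, mul_comm]

theorem hasDerivAt_trace_pow (K : Matrix ι ι ℝ) (x : ι → ℝ) (n : ℕ) (τ : ℝ) :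
    HasDerivAt (fun τ : ℝ => ((K - τ • Matrix.vecMulVec x x) ^ n).trace)
      (-(n * (x ⬝ᵥ ((K - τ • Matrix.vecMulVec x x) ^ (n - 1) *ᵥ x)))) τ := by
  refine ((LinearMap.toContinuousLinearMap
    (Matrix.traceLinearMap ι ℝ ℝ)).hasFDerivAt.comp_hasDerivAt
    τ (hasDerivAt_sub_smul_pow K x n τ)).congr_deriv ?_
  change Matrix.traceLinearMap ι ℝ ℝ _ = _
  rw [map_neg, map_sum, Finset.sum_congr rfl (g := fun _ =>
    x ⬝ᵥ ((K - τ • Matrix.vecMulVec x x) ^ (n - 1) *ᵥ x))]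
  · simp
  · intro i hi
    rw [Matrix.traceLinearMap_apply, Matrix.mul_assoc, Matrix.trace_mul_comm, Matrix.mul_assoc,
      ← pow_add, show i + (n - 1 - i) = n - 1 by have := Finset.mem_range.1 hi; omega,
      Matrix.vecMulVec_eq Unit, Matrix.mul_assoc, Matrix.trace_mul_comm]
    simp [Matrix.trace, Matrix.mul_apply, dotProduct, Matrix.mulVec, Finset.sum_mul, Finset.mul_sum]
    rw [Finset.sum_comm]
    exact Finset.sum_congr rfl fun a _ => Finset.sum_congr rfl fun b _ => by ring

/-- `x ⬝ p x`, where `p` is the sum of the first `N` terms of the exponential series of `K`. -/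
noncomputable def quadraticExpPartial (K : Matrix ι ι ℝ) (x : ι → ℝ) (N : ℕ) : ℝ :=
  ∑ n ∈ Finset.range N, (x ⬝ᵥ (K ^ n *ᵥ x)) / n !

/-- The trace of the sum of the first `N` terms of the exponential series of `K`. -/
noncomputable def traceExpPartial (K : Matrix ι ι ℝ) (N : ℕ) : ℝ :=
  ∑ n ∈ Finset.range N, (K ^ n).trace / n !

theorem hasDerivAt_traceExpPartial (K : Matrix ι ι ℝ) (x : ι → ℝ) (N : ℕ) (τ : ℝ) :
    HasDerivAt (fun τ : ℝ => traceExpPartial (K - τ • Matrix.vecMulVec x x) (N + 1))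
      (-quadraticExpPartial (K - τ • Matrix.vecMulVec x x) x N) τ := by
  have h := HasDerivAt.fun_sum (u := Finset.range (N + 1)) fun n _ =>
    (hasDerivAt_trace_pow K x n τ).div_const (n ! : ℝ)
  refine h.congr_deriv ?_
  rw [Finset.sum_range_succ', quadraticExpPartial, ← Finset.sum_neg_distrib]
  simp only [Nat.cast_zero, zero_mul, neg_zero, zero_div, add_zero]
  refine Finset.sum_congr rfl fun n _ => ?_
  rw [Nat.factorial_succ]
  push_cast
  have : (n ! : ℝ) ≠ 0 := by positivity
  have : (n + 1 : ℝ) ≠ 0 := by positivity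
  field_simp

/-- The quadratic form decays at rate at most `R` along the path `τ ↦ K - τ x xᵀ`. In degree `n` the
derivative of `Kⁿ` has `n` summands, each a product of two moments whose degrees add up to `n - 1`,
and each is bounded by Chebyshev's inequality. -/
theorem exists_hasDerivAt_quadraticExpPartial (K : Matrix ι ι ℝ) (x : ι → ℝ) {R : ℝ}
    (hx : x ⬝ᵥ x ≤ R) (N : ℕ) (τ : ℝ) (hK : (K - τ • Matrix.vecMulVec x x).PosSemidef) :
    ∃ d, HasDerivAt (fun τ : ℝ => quadraticExpPartial (K - τ • Matrix.vecMulVec x x) x N) d τ ∧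
      -(R * quadraticExpPartial (K - τ • Matrix.vecMulVec x x) x N) ≤ d := by
  have hR : 0 ≤ R := (Finset.sum_nonneg fun a _ => mul_self_nonneg (x a)).trans hx
  refine ⟨_, HasDerivAt.fun_sum (u := Finset.range N) fun n _ =>
    (hasDerivAt_quadratic_pow K x n τ).div_const (n ! : ℝ), ?_⟩
  generalize hL : K - τ • Matrix.vecMulVec x x = L at hK
  rcases N with _ | N
  · simp [quadraticExpPartial]
  rw [Finset.sum_range_succ', quadraticExpPartial, Finset.sum_range_succ]
  simp only [Finset.range_zero, Finset.sum_empty, neg_zero, zero_div, add_zero]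
  have h1 : -(R * ∑ n ∈ Finset.range N, (x ⬝ᵥ (L ^ n *ᵥ x)) / n !) ≤
      ∑ n ∈ Finset.range N, (-∑ i ∈ Finset.range (n + 1), (x ⬝ᵥ (L ^ (n + 1 - 1 - i) *ᵥ x)) *
        (x ⬝ᵥ (L ^ i *ᵥ x))) / ((n + 1)! : ℝ) := by
    rw [Finset.mul_sum, ← Finset.sum_neg_distrib]
    refine Finset.sum_le_sum fun n _ => ?_
    have h2 : ∑ i ∈ Finset.range (n + 1), (x ⬝ᵥ (L ^ (n + 1 - 1 - i) *ᵥ x)) *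
        (x ⬝ᵥ (L ^ i *ᵥ x)) ≤ ∑ i ∈ Finset.range (n + 1), R * (x ⬝ᵥ (L ^ n *ᵥ x)) := by
      refine Finset.sum_le_sum fun i hi => (quadratic_pow_mul_le hK x _ _).trans ?_
      rw [show n + 1 - 1 - i + i = n by have := Finset.mem_range.1 hi; omega]
      exact mul_le_mul_of_nonneg_right hx (quadratic_pow_nonneg hK x n)
    rw [Finset.sum_const, Finset.card_range, nsmul_eq_mul] at h2
    rw [neg_div, neg_le_neg_iff, div_le_iff₀ (by positivity), Nat.factorial_succ]
    refine h2.trans_eq ?_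
    have : (n ! : ℝ) ≠ 0 := by positivity
    push_cast
    field_simp
  have h3 : 0 ≤ R * ((x ⬝ᵥ (L ^ N *ᵥ x)) / N !) :=
    mul_nonneg hR (div_nonneg (quadratic_pow_nonneg hK x N) (by positivity))
  linarith

/-- The quadratic form decays no faster than `exp (-R τ)`, and the trace decreases at the rate of the
quadratic form; integrating over `[0, t]` produces the factor `(1 - exp (-R t)) / R`. -/
theorem traceExpPartial_sub_le (K : Matrix ι ι ℝ) (x : ι → ℝ) {R t : ℝ} (hR : 0 < R)
    (ht : 0 ≤ t) (hx : x ⬝ᵥ x ≤ R) (N : ℕ)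
    (hK : ∀ τ ∈ Set.Icc 0 t, (K - τ • Matrix.vecMulVec x x).PosSemidef) :
    traceExpPartial (K - t • Matrix.vecMulVec x x) (N + 1) ≤
      traceExpPartial K (N + 1) - (1 - Real.exp (-(R * t))) / R * quadraticExpPartial K x N := by
  have hexp : ∀ τ : ℝ, HasDerivAt (fun τ : ℝ => Real.exp (R * τ)) (Real.exp (R * τ) * R) τ :=
    fun τ => by simpa using ((hasDerivAt_id τ).const_mul R).exp
  have hexp' : ∀ τ : ℝ, HasDerivAt (fun τ : ℝ => Real.exp (-(R * τ)))
      (Real.exp (-(R * τ)) * -R) τ :=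
    fun τ => by simpa using ((hasDerivAt_id τ).const_mul R).neg.exp
  have h0 : K - (0 : ℝ) • Matrix.vecMulVec x x = K := by simp
  have hq : ∀ τ ∈ Set.Icc 0 t, Real.exp (-(R * τ)) * quadraticExpPartial K x N ≤
      quadraticExpPartial (K - τ • Matrix.vecMulVec x x) x N := by
    choose! d hd hd' using fun τ hτ =>
      exists_hasDerivAt_quadraticExpPartial K x hx N τ (hK τ hτ)
    have hmono := monotoneOn_of_hasDerivWithinAt_nonneg (convex_Icc 0 t)
      (f := fun τ => Real.exp (R * τ) * quadraticExpPartial (K - τ • Matrix.vecMulVec x x) x N)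
      (fun τ hτ => ((hexp τ).mul (hd τ hτ)).continuousAt.continuousWithinAt)
      (fun τ hτ => ((hexp τ).mul (hd τ (interior_subset hτ))).hasDerivWithinAt)
      (fun τ hτ => by
        have := mul_le_mul_of_nonneg_left (hd' τ (interior_subset hτ)) (Real.exp_pos (R * τ)).le
        linarith)
    intro τ hτ
    have := hmono (Set.left_mem_Icc.2 ht) hτ hτ.1
    simp only [h0, mul_zero, Real.exp_zero, one_mul] at this
    rw [Real.exp_neg, inv_mul_le_iff₀ (Real.exp_pos _)]
    exact this
  -- Adding the integral of the lower bound to the trace leaves a function which still decreases.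
  have hd : ∀ τ : ℝ, HasDerivAt (fun τ : ℝ =>
      traceExpPartial (K - τ • Matrix.vecMulVec x x) (N + 1) +
        (1 - Real.exp (-(R * τ))) / R * quadraticExpPartial K x N)
      (-quadraticExpPartial (K - τ • Matrix.vecMulVec x x) x N +
        Real.exp (-(R * τ)) * quadraticExpPartial K x N) τ := fun τ => by
    refine ((hasDerivAt_traceExpPartial K x N τ).add
      ((((hexp' τ).const_sub 1).div_const R).mul_const (quadraticExpPartial K x N))).congr_deriv ?_
    field_simp
  have hanti := antitoneOn_of_hasDerivWithinAt_nonpos (convex_Icc 0 t)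
    (fun τ _ => (hd τ).continuousAt.continuousWithinAt)
    (fun τ _ => (hd τ).hasDerivWithinAt)
    (fun τ hτ => by linarith [hq τ (interior_subset hτ)])
  have := hanti (Set.left_mem_Icc.2 ht) (Set.right_mem_Icc.2 ht) ht
  simp only [h0, mul_zero, neg_zero, Real.exp_zero, sub_self, zero_div, zero_mul, add_zero] at this
  linarith

theorem tendsto_traceExpPartial (K : Matrix ι ι ℝ) :
    Filter.Tendsto (traceExpPartial K) Filter.atTop (nhds (NormedSpace.exp K).trace) := by
  have h := (NormedSpace.exp_series_hasSum_exp' (𝕂 := ℝ) K).map (Matrix.traceLinearMap ι ℝ ℝ)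
    (LinearMap.toContinuousLinearMap (Matrix.traceLinearMap ι ℝ ℝ)).continuous
  refine h.tendsto_sum_nat.congr fun N => Finset.sum_congr rfl fun n _ => ?_
  simp [div_eq_inv_mul]

theorem tendsto_quadraticExpPartial (K : Matrix ι ι ℝ) (x : ι → ℝ) :
    Filter.Tendsto (quadraticExpPartial K x) Filter.atTop
      (nhds (x ⬝ᵥ (NormedSpace.exp K *ᵥ x))) := by
  have hc : Continuous fun M : Matrix ι ι ℝ => x ⬝ᵥ (M *ᵥ x) := by fun_prop
  refine ((hc.tendsto _).comp
    (NormedSpace.exp_series_hasSum_exp' (𝕂 := ℝ) K).tendsto_sum_nat).congr fun N => ?_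
  simp only [Function.comp, Matrix.sum_mulVec, dotProduct_sum, quadraticExpPartial]
  refine Finset.sum_congr rfl fun n _ => ?_
  rw [Matrix.smul_mulVec, dotProduct_smul, smul_eq_mul, div_eq_inv_mul]

/-- The rank-one case of the Golden–Thompson inequality, in the form in which it is averaged
over `x`. -/
theorem trace_exp_sub_le (K : Matrix ι ι ℝ) (x : ι → ℝ) {R t : ℝ} (hR : 0 < R)
    (ht : 0 ≤ t) (hx : x ⬝ᵥ x ≤ R)
    (hK : ∀ τ ∈ Set.Icc 0 t, (K - τ • Matrix.vecMulVec x x).PosSemidef) :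
    (NormedSpace.exp (K - t • Matrix.vecMulVec x x)).trace ≤
      (NormedSpace.exp K).trace -
        (1 - Real.exp (-(R * t))) / R * (x ⬝ᵥ (NormedSpace.exp K *ᵥ x)) :=
  le_of_tendsto_of_tendsto'
    ((tendsto_traceExpPartial _).comp (Filter.tendsto_add_atTop_nat 1))
    (((tendsto_traceExpPartial K).comp (Filter.tendsto_add_atTop_nat 1)).sub
      ((tendsto_quadraticExpPartial K x).const_mul _))
    fun N => traceExpPartial_sub_le K x hR ht hx N hK

theorem trace_exp_eq_sum_eigenvalues {K : Matrix ι ι ℝ} (hK : K.IsHermitian) :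
    (NormedSpace.exp K).trace = ∑ a, Real.exp (hK.eigenvalues a) := by
  have h : Filter.Tendsto
      (fun N => ∑ a, ∑ n ∈ Finset.range N, ((n ! : ℝ)⁻¹) • hK.eigenvalues a ^ n) Filter.atTop
      (nhds (∑ a, Real.exp (hK.eigenvalues a))) :=
    tendsto_finsetSum _ fun a _ => by
      rw [Real.exp_eq_exp_ℝ]
      exact (NormedSpace.exp_series_hasSum_exp' (𝕂 := ℝ) (hK.eigenvalues a)).tendsto_sum_nat
  refine tendsto_nhds_unique (tendsto_traceExpPartial K) (h.congr fun N => ?_)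
  rw [Finset.sum_comm]
  refine Finset.sum_congr rfl fun n _ => ?_
  rw [trace_pow_eq_sum_eigenvalues hK, Finset.sum_div]
  exact Finset.sum_congr rfl fun a _ => by rw [smul_eq_mul, div_eq_inv_mul]

theorem exp_le_trace_exp {K : Matrix ι ι ℝ} (hK : K.IsHermitian) {μ : ℝ}
    (hμ : μ ∈ spectrum ℝ K) : Real.exp μ ≤ (NormedSpace.exp K).trace := by
  obtain ⟨a, rfl⟩ : μ ∈ Set.range hK.eigenvalues := hK.spectrum_real_eq_range_eigenvalues ▸ hμ
  rw [trace_exp_eq_sum_eigenvalues hK]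
  exact Finset.single_le_sum (f := fun b => Real.exp (hK.eigenvalues b))
    (fun b _ => (Real.exp_pos _).le) (Finset.mem_univ a)

theorem trace_exp_nonneg {K : Matrix ι ι ℝ} (hK : K.IsHermitian) :
    0 ≤ (NormedSpace.exp K).trace := by
  rw [trace_exp_eq_sum_eigenvalues hK]
  exact Finset.sum_nonneg fun a _ => (Real.exp_pos _).le

theorem trace_exp_smul_one (c : ℝ) :
    (NormedSpace.exp (c • (1 : Matrix ι ι ℝ))).trace = Fintype.card ι * Real.exp c := by
  rw [Matrix.smul_one_eq_diagonal, Matrix.exp_diagonal, Matrix.trace_diagonal,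
    Real.exp_eq_exp_ℝ]
  simp [Pi.coe_exp]

end RankOne

/-! ### A matrix Chernoff bound -/

section Chernoff

variable {ι : Type*} [Fintype ι] [DecidableEq ι]

theorem posSemidef_smul_one_sub_smul_vecMulVec (x : ι → ℝ) {R τ t : ℝ} (hR : 0 ≤ R) (hτ : 0 ≤ τ)
    (hτt : τ ≤ t) (hx : x ⬝ᵥ x ≤ R) :
    ((t * R) • (1 : Matrix ι ι ℝ) - τ • Matrix.vecMulVec x x).PosSemidef := by
  refine Matrix.PosSemidef.of_dotProduct_mulVec_nonneg ?_ fun y => ?_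
  · ext a b
    simp [Matrix.one_apply, Matrix.vecMulVec_apply, mul_comm, eq_comm]
  · have hcs : (x ⬝ᵥ y) ^ 2 ≤ (x ⬝ᵥ x) * (y ⬝ᵥ y) := by
      simpa [dotProduct, sq] using Finset.sum_mul_sq_le_sq_mul_sq Finset.univ x y
    have hy : 0 ≤ y ⬝ᵥ y := Finset.sum_nonneg fun a _ => mul_self_nonneg _
    have h : star y ⬝ᵥ (((t * R) • (1 : Matrix ι ι ℝ) - τ • Matrix.vecMulVec x x) *ᵥ y) =
        t * R * (y ⬝ᵥ y) - τ * (x ⬝ᵥ y) ^ 2 := by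
      simp [Matrix.sub_mulVec, Matrix.smul_mulVec, Matrix.vecMulVec_mulVec, dotProduct_sub,
        dotProduct_comm y x, sq]
    rw [h]
    have h1 : τ * (x ⬝ᵥ y) ^ 2 ≤ τ * (R * (y ⬝ᵥ y)) :=
      mul_le_mul_of_nonneg_left (hcs.trans (mul_le_mul_of_nonneg_right hx hy)) hτ
    have h2 : τ * (R * (y ⬝ᵥ y)) ≤ t * (R * (y ⬝ᵥ y)) :=
      mul_le_mul_of_nonneg_right hτt (mul_nonneg hR hy)
    linarith

variable {α : Type*} [Fintype α] {p : α → ℝ} {x : α → ι → ℝ} {R t κ : ℝ}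

/-- Averaging over one isotropic random vector contracts the potential `tr exp`: linearity of the
trace turns the mean of `x ⬝ exp K x` into `κ tr exp K`. -/
theorem sum_mul_trace_exp_sub_le (hp : ∀ a, 0 ≤ p a) (hp1 : ∑ a, p a = 1)
    (hx : ∀ a, x a ⬝ᵥ x a ≤ R) (hiso : ∑ a, p a • Matrix.vecMulVec (x a) (x a) = κ • 1)
    (hR : 0 < R) (ht : 0 ≤ t) {K : Matrix ι ι ℝ} (hK : (K - (t * R) • 1).PosSemidef) :
    ∑ a, p a * (NormedSpace.exp (K - t • Matrix.vecMulVec (x a) (x a))).trace ≤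
      Real.exp (-((1 - Real.exp (-(R * t))) / R * κ)) * (NormedSpace.exp K).trace := by
  have hKh : K.IsHermitian := by
    have h : K = (K - (t * R) • 1) + (t * R) • 1 := by rw [sub_add_cancel]
    rw [h]
    exact hK.1.add (by simp [Matrix.IsHermitian])
  have hquad : ∑ a, p a * (x a ⬝ᵥ (NormedSpace.exp K *ᵥ x a)) =
      κ * (NormedSpace.exp K).trace := by
    have h := congrArg (fun M => (NormedSpace.exp K * M).trace) hiso
    simp only [Finset.mul_sum, Matrix.trace_sum, Matrix.mul_smul, Matrix.trace_smul, smul_eq_mul,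
      Matrix.mul_one] at h
    rw [← h]
    refine Finset.sum_congr rfl fun a _ => ?_
    rw [Matrix.mul_vecMulVec, Matrix.trace_vecMulVec, dotProduct_comm]
  have hstep : ∀ a, p a * (NormedSpace.exp (K - t • Matrix.vecMulVec (x a) (x a))).trace ≤
      p a * (NormedSpace.exp K).trace - (1 - Real.exp (-(R * t))) / R *
        (p a * (x a ⬝ᵥ (NormedSpace.exp K *ᵥ x a))) := fun a => by
    refine (mul_le_mul_of_nonneg_left (trace_exp_sub_le K (x a) hR ht (hx a) fun τ hτ => ?_)
      (hp a)).trans_eq (by ring)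
    have h := hK.add
      (posSemidef_smul_one_sub_smul_vecMulVec (x a) hR.le hτ.1 hτ.2 (hx a))
    rwa [sub_add_sub_cancel] at h
  refine (Finset.sum_le_sum fun a _ => hstep a).trans ?_
  rw [Finset.sum_sub_distrib, ← Finset.sum_mul, ← Finset.mul_sum, hp1, hquad]
  refine le_trans (le_of_eq ?_) (mul_le_mul_of_nonneg_right
    (Real.add_one_le_exp (-((1 - Real.exp (-(R * t))) / R * κ))) (trace_exp_nonneg hKh))
  ring

/-- The one-vector contraction iterated over `ℓ` independent vectors. The margin `ℓ t R` keeps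
every intermediate matrix positive semidefinite. -/
theorem sum_prod_mul_trace_exp_sub_le (hp : ∀ a, 0 ≤ p a) (hp1 : ∑ a, p a = 1)
    (hx : ∀ a, x a ⬝ᵥ x a ≤ R) (hiso : ∑ a, p a • Matrix.vecMulVec (x a) (x a) = κ • 1)
    (hR : 0 < R) (ht : 0 ≤ t) (ℓ : ℕ) {K : Matrix ι ι ℝ}
    (hK : (K - (ℓ * (t * R)) • 1).PosSemidef) :
    ∑ i : Fin ℓ → α, (∏ j, p (i j)) *
        (NormedSpace.exp (K - t • ∑ j, Matrix.vecMulVec (x (i j)) (x (i j)))).trace ≤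
      Real.exp (-((1 - Real.exp (-(R * t))) / R * κ)) ^ ℓ * (NormedSpace.exp K).trace := by
  induction ℓ generalizing K with
  | zero => simp
  | succ ℓ ih =>
    have htR : 0 ≤ t * R := mul_nonneg ht hR.le
    rw [← (Fin.consEquiv fun _ => α).sum_comp, Fintype.sum_prod_type]
    have hinner : ∀ a, ∑ i : Fin ℓ → α, (∏ j, p ((Fin.cons a i : Fin (ℓ + 1) → α) j)) *
        (NormedSpace.exp (K - t • ∑ j, Matrix.vecMulVec (x ((Fin.cons a i : Fin (ℓ + 1) → α) j))
          (x ((Fin.cons a i : Fin (ℓ + 1) → α) j)))).trace ≤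
        Real.exp (-((1 - Real.exp (-(R * t))) / R * κ)) ^ ℓ *
          (p a * (NormedSpace.exp (K - t • Matrix.vecMulVec (x a) (x a))).trace) := fun a => by
      have h := ih (K := K - t • Matrix.vecMulVec (x a) (x a)) (by
        have h := hK.add
          (posSemidef_smul_one_sub_smul_vecMulVec (x a) hR.le ht le_rfl (hx a))
        convert h using 1
        push_cast
        rw [add_mul, one_mul, add_smul]
        abel)
      refine le_trans (le_of_eq ?_) ((mul_le_mul_of_nonneg_left h (hp a)).trans_eq (by ring))
      rw [Finset.mul_sum]
      refine Finset.sum_congr rfl fun i _ => ?_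
      rw [Fin.prod_univ_succ, Fin.sum_univ_succ]
      simp only [Fin.cons_zero, Fin.cons_succ]
      rw [smul_add, sub_sub, mul_assoc]
    refine (Finset.sum_le_sum fun a _ => hinner a).trans ?_
    rw [← Finset.mul_sum, pow_succ, mul_assoc]
    refine mul_le_mul_of_nonneg_left (sum_mul_trace_exp_sub_le hp hp1 hx hiso hR ht ?_)
      (pow_nonneg (Real.exp_pos _).le ℓ)
    have h := hK.add (Matrix.PosSemidef.one.smul (mul_nonneg (Nat.cast_nonneg ℓ) htR))
    convert h using 1
    push_cast
    rw [add_mul, one_mul, add_smul]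
    abel

theorem isHermitian_smul_one_sub_smul_sum {ι : Type*} [DecidableEq ι] {ℓ : ℕ} (c t : ℝ)
    (y : Fin ℓ → ι → ℝ) :
    (c • 1 - t • ∑ j, Matrix.vecMulVec (y j) (y j)).IsHermitian := by
  ext a b
  simp [Matrix.one_apply, Matrix.sum_apply, Matrix.vecMulVec_apply, mul_comm, eq_comm]

theorem exp_neg_le_quadratic {u : ℝ} (hu : 0 ≤ u) : Real.exp (-u) ≤ 1 - u + u ^ 2 / 2 := by
  rw [Real.exp_neg, inv_le_iff_one_le_mul₀ (Real.exp_pos u)]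
  have h1 := Real.quadratic_le_exp_of_nonneg hu
  have h2 : 0 ≤ 1 - u + u ^ 2 / 2 := by nlinarith [sq_nonneg (u - 1)]
  nlinarith [mul_le_mul_of_nonneg_left h1 h2, sq_nonneg (u ^ 2)]

open Classical in
/-- The lower matrix Chernoff bound for a sum of `ℓ` independent isotropic rank-one matrices,
written as a bound on the mass which the product weights give to the bad samples. -/
theorem sum_prod_filter_spectrum_lt_le (hp : ∀ a, 0 ≤ p a) (hp1 : ∑ a, p a = 1)
    (hx : ∀ a, x a ⬝ᵥ x a ≤ R) (hiso : ∑ a, p a • Matrix.vecMulVec (x a) (x a) = κ • 1)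
    (hR : 0 < R) (hκ : 0 ≤ κ) (ℓ : ℕ) {δ : ℝ} (hδ : 0 ≤ δ) :
    ∑ i : Fin ℓ → α with ∃ μ ∈ spectrum ℝ (∑ j, Matrix.vecMulVec (x (i j)) (x (i j))),
        μ < (1 - δ) * (ℓ * κ), ∏ j, p (i j) ≤
      Fintype.card ι * Real.exp (-(δ ^ 2 * (ℓ * κ) / (2 * R))) := by
  -- The parameter `t = δ / R` gives the quadratic exponent directly, for every `δ ≥ 0`.
  obtain ⟨t, ht⟩ : ∃ t, t = δ / R := ⟨_, rfl⟩
  have ht0 : 0 ≤ t := ht ▸ div_nonneg hδ hR.le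
  have hRt : R * t = δ := by rw [ht]; field_simp
  set c : ℝ := ℓ * (t * R) with hc
  set θ : ℝ := (1 - δ) * (ℓ * κ) with hθ
  have hmain := sum_prod_mul_trace_exp_sub_le (K := c • 1) hp hp1 hx hiso hR ht0 ℓ (by
    rw [sub_self]; exact Matrix.PosSemidef.zero)
  have hbad : ∀ i : Fin ℓ → α,
      (∃ μ ∈ spectrum ℝ (∑ j, Matrix.vecMulVec (x (i j)) (x (i j))), μ < θ) →
      Real.exp (c - t * θ) ≤
        (NormedSpace.exp (c • 1 - t • ∑ j, Matrix.vecMulVec (x (i j)) (x (i j)))).trace := by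
    rintro i ⟨μ, hμ, hμθ⟩
    refine (Real.exp_le_exp.2 (sub_le_sub_left (mul_le_mul_of_nonneg_left hμθ.le ht0) c)).trans
      (exp_le_trace_exp (isHermitian_smul_one_sub_smul_sum c t fun j => x (i j)) ?_)
    have h := spectrum.subset_polynomial_aeval (∑ j, Matrix.vecMulVec (x (i j)) (x (i j)))
      (Polynomial.C c - Polynomial.C t * Polynomial.X) (Set.mem_image_of_mem _ hμ)
    simpa [Algebra.algebraMap_eq_smul_one] using h
  have hmarkov : Real.exp (c - t * θ) * ∑ i : Fin ℓ → α with
        ∃ μ ∈ spectrum ℝ (∑ j, Matrix.vecMulVec (x (i j)) (x (i j))), μ < θ, ∏ j, p (i j) ≤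
      ∑ i : Fin ℓ → α, (∏ j, p (i j)) *
        (NormedSpace.exp (c • 1 - t • ∑ j, Matrix.vecMulVec (x (i j)) (x (i j)))).trace := by
    have hprod : ∀ i : Fin ℓ → α, 0 ≤ ∏ j, p (i j) := fun i => Finset.prod_nonneg fun j _ => hp _
    rw [Finset.mul_sum]
    refine (Finset.sum_le_sum fun i hi => ?_).trans
      (Finset.sum_le_sum_of_subset_of_nonneg (Finset.filter_subset _ _) fun i _ _ =>
        mul_nonneg (hprod i)
          (trace_exp_nonneg (isHermitian_smul_one_sub_smul_sum c t fun j => x (i j))))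
    rw [mul_comm]
    exact mul_le_mul_of_nonneg_left (hbad i (Finset.mem_filter.1 hi).2) (hprod i)
  have h := hmarkov.trans hmain
  rw [← le_div_iff₀' (Real.exp_pos _), trace_exp_smul_one] at h
  refine h.trans ?_
  rw [← Real.exp_nat_mul, hRt, mul_left_comm, mul_div_assoc, ← Real.exp_add, ← Real.exp_sub]
  refine mul_le_mul_of_nonneg_left (Real.exp_le_exp.2 ?_) (Nat.cast_nonneg _)
  have hq := exp_neg_le_quadratic hδ
  have hm : 0 ≤ ℓ * κ / R := div_nonneg (mul_nonneg (Nat.cast_nonneg ℓ) hκ) hR.le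
  have e1 : ℓ * -((1 - Real.exp (-δ)) / R * κ) + c - (c - t * θ) =
      (ℓ * κ / R) * (δ * (1 - δ) - (1 - Real.exp (-δ))) := by
    rw [hθ, ht]; field_simp; ring
  have e2 : -(δ ^ 2 * (ℓ * κ) / (2 * R)) = (ℓ * κ / R) * (-(δ ^ 2 / 2)) := by
    field_simp
  rw [e1, e2]
  exact mul_le_mul_of_nonneg_left (by linarith) hm

end Chernoff

/-! ### Sampling rows with prescribed scores -/

section Sampling

variable {n k : ℕ}

theorem leverage_eq_dotProduct (V₁ : Matrix (Fin n) (Fin k) ℝ) (i : Fin n) :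
    leverage V₁ i = V₁ i ⬝ᵥ V₁ i := by
  rw [leverage, EuclideanSpace.real_norm_sq_eq]
  simp [dotProduct, sq]

theorem leverage_nonneg (V₁ : Matrix (Fin n) (Fin k) ℝ) (i : Fin n) : 0 ≤ leverage V₁ i :=
  sq_nonneg _

theorem leverage_div_le_scoreRatio (V₁ : Matrix (Fin n) (Fin k) ℝ) (s : Fin n → ℝ) (i : Fin n) :
    leverage V₁ i / s i ≤ scoreRatio V₁ s :=
  le_ciSup (f := fun i => leverage V₁ i / s i) (Set.finite_range _).bddAbove i

theorem firstColumns_transpose_mul_self {ρ : ℕ} {V : Matrix (Fin n) (Fin ρ) ℝ} (hV : Vᵀ * V = 1)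
    (h : k ≤ ρ) : (firstColumns V h)ᵀ * firstColumns V h = 1 := by
  rw [firstColumns, Matrix.transpose_submatrix,
    ← Matrix.submatrix_mul Vᵀ V _ id _ Function.bijective_id, hV,
    Matrix.submatrix_one _ (Fin.castLE_injective h)]

theorem sum_leverage {V₁ : Matrix (Fin n) (Fin k) ℝ} (hV : V₁ᵀ * V₁ = 1) :
    ∑ i, leverage V₁ i = k := by
  have h := congrArg Matrix.trace hV
  rw [Matrix.trace_one, Fintype.card_fin, Matrix.trace_mul_comm] at h
  rw [← h]
  exact Finset.sum_congr rfl fun i _ => leverage_eq_dotProduct V₁ i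

theorem scoreRatio_pos {V₁ : Matrix (Fin n) (Fin k) ℝ} (hV : V₁ᵀ * V₁ = 1) (hk : 1 ≤ k)
    {s : Fin n → ℝ} (hpos : ∀ i, 0 < leverage V₁ i → 0 < s i) : 0 < scoreRatio V₁ s := by
  have h : 0 < ∑ i, leverage V₁ i := by rw [sum_leverage hV]; exact_mod_cast hk
  obtain ⟨i, -, hi⟩ := Finset.exists_lt_of_sum_lt (f := fun _ => (0 : ℝ)) (s := Finset.univ)
    (by simpa using h)
  exact (div_pos hi (hpos i hi)).trans_le (leverage_div_le_scoreRatio V₁ s i)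

/-- The column of `Ω₁` contributed by the index `i`; it is `0` when `s i = 0`. -/
noncomputable def scaledRow (V₁ : Matrix (Fin n) (Fin k) ℝ) (s : Fin n → ℝ) (i : Fin n) :
    Fin k → ℝ :=
  (1 / √(s i)) • V₁ i

theorem scaledRow_dotProduct_self (V₁ : Matrix (Fin n) (Fin k) ℝ) {s : Fin n → ℝ}
    (hs : ∀ i, 0 ≤ s i) (i : Fin n) :
    scaledRow V₁ s i ⬝ᵥ scaledRow V₁ s i = leverage V₁ i / s i := by
  rw [scaledRow, dotProduct_smul, smul_dotProduct, leverage_eq_dotProduct, smul_smul, smul_eq_mul,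
    div_mul_div_comm, Real.mul_self_sqrt (hs i)]
  ring

/-- The scores cancel in expectation. An index with `s i = 0` has leverage `0`, so its vanishing
contribution is the correct one. -/
theorem sum_smul_vecMulVec_scaledRow {V₁ : Matrix (Fin n) (Fin k) ℝ} (hV : V₁ᵀ * V₁ = 1)
    {s : Fin n → ℝ} (hs : ∀ i, 0 ≤ s i) (hpos : ∀ i, 0 < leverage V₁ i → 0 < s i) :
    ∑ i, (s i / k) • Matrix.vecMulVec (scaledRow V₁ s i) (scaledRow V₁ s i) =
      (1 / k : ℝ) • 1 := by
  have hi : ∀ i, s i • Matrix.vecMulVec (scaledRow V₁ s i) (scaledRow V₁ s i) =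
      Matrix.vecMulVec (V₁ i) (V₁ i) := fun i => by
    rcases (hs i).eq_or_lt with h | h
    · have hl : leverage V₁ i = 0 := by
        by_contra hne
        exact (hpos i ((leverage_nonneg V₁ i).lt_of_ne' hne)).ne h
      rw [leverage_eq_dotProduct, dotProduct_self_eq_zero] at hl
      rw [← h, hl]
      simp
    · rw [scaledRow, Matrix.smul_vecMulVec, Matrix.vecMulVec_smul, smul_smul, smul_smul, mul_assoc,
        div_mul_div_comm, Real.mul_self_sqrt h.le, mul_one, mul_one_div_cancel h.ne', one_smul]
  have hsum : ∑ i, Matrix.vecMulVec (V₁ i) (V₁ i) = 1 := by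
    rw [← hV]
    ext a b
    simp [Matrix.sum_apply, Matrix.vecMulVec_apply, Matrix.mul_apply]
  rw [← hsum, Finset.smul_sum]
  refine Finset.sum_congr rfl fun i _ => ?_
  rw [← hi, smul_smul]
  congr 1
  ring

theorem sampledTop_mul_transpose {ℓ : ℕ} (V₁ : Matrix (Fin n) (Fin k) ℝ) (s : Fin n → ℝ)
    (i : Fin ℓ → Fin n) :
    sampledTop V₁ s i * (sampledTop V₁ s i)ᵀ =
      ∑ j, Matrix.vecMulVec (scaledRow V₁ s (i j)) (scaledRow V₁ s (i j)) := by
  have h : ∀ a j, sampledTop V₁ s i a j = scaledRow V₁ s (i j) a := fun a j => by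
    simp [sampledTop, samplingMatrix, rescalingMatrix, scaledRow, Matrix.mul_apply,
      Matrix.diagonal_apply, mul_comm]
  ext a b
  simp [Matrix.mul_apply, Matrix.sum_apply, Matrix.vecMulVec_apply, h]

theorem exists_mem_spectrum_lt {M : Matrix (Fin k) (Fin k) ℝ} (hM : M.IsHermitian) (hk : 1 ≤ k)
    {θ : ℝ} (h : lambdaMin M < θ) : ∃ μ ∈ spectrum ℝ M, μ < θ :=
  exists_lt_of_csInf_lt ⟨_, hM.eigenvalues_mem_spectrum_real ⟨0, hk⟩⟩ h

theorem measureReal_preimage_eq_sum_prod {ℓ : ℕ} {W : Type*} [MeasurableSpace W] (P : Measure W)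
    [IsProbabilityMeasure P] {I : Fin ℓ → W → Fin n} (hmeas : ∀ j, Measurable (I j))
    (hindep : iIndepFun I P) (B : Finset (Fin ℓ → Fin n)) :
    P.real ((fun w j => I j w) ⁻¹' (B : Set (Fin ℓ → Fin n))) =
      ∑ i ∈ B, ∏ j, P.real (I j ⁻¹' {i j}) := by
  have hm : Measurable fun w j => I j w := measurable_pi_lambda _ hmeas
  rw [← sum_measureReal_preimage_singleton B fun i _ => hm (measurableSet_singleton i)]
  refine Finset.sum_congr rfl fun i _ => ?_
  have h := hindep.measure_inter_preimage_eq_mul Finset.univ (sets := fun j => {i j})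
    fun j _ => measurableSet_singleton _
  have he : (fun w j => I j w) ⁻¹' {i} = ⋂ j ∈ Finset.univ, I j ⁻¹' {i j} := by
    ext w
    simp [funext_iff]
  rw [he, measureReal_def, h, ENNReal.toReal_prod]
  rfl

end Sampling

end ColumnSampling

theorem mainTheorem3 {m n : ℕ} (A : Matrix (Fin m) (Fin n) ℝ)
    (U : Matrix (Fin m) (Fin A.rank) ℝ) (σ : Fin A.rank → ℝ)
    (V : Matrix (Fin n) (Fin A.rank) ℝ) (hSVD : ColumnSampling.IsSVD A U σ V)
    (k : ℕ) (hk : 1 ≤ k) (hkρ : k < A.rank)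
    (V₁ : Matrix (Fin n) (Fin k) ℝ) (hV₁ : V₁ = ColumnSampling.firstColumns V hkρ.le)
    (s : Fin n → ℝ) (hs : ∀ i, 0 ≤ s i) (hsum : ∑ i, s i = (k : ℝ))
    (hpos : ∀ i, 0 < ColumnSampling.leverage V₁ i → 0 < s i)
    (ℓ : ℕ) {W : Type*} [MeasurableSpace W] (P : Measure W) [IsProbabilityMeasure P]
    (I : Fin ℓ → W → Fin n) (hmeas : ∀ j, Measurable (I j)) (hindep : iIndepFun I P)
    (hlaw : ∀ j i, P.real (I j ⁻¹' {i}) = s i / ∑ a, s a)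
    (δ : ℝ) (hδ : 0 ≤ δ) :
    1 - (k : ℝ) * Real.exp (-(δ ^ 2 * ℓ / (2 * k * ColumnSampling.scoreRatio V₁ s))) ≤
      P.real {w | (1 - δ) * (ℓ / k) ≤
        ColumnSampling.lambdaMin
          (ColumnSampling.sampledTop V₁ s (fun j => I j w) *
            (ColumnSampling.sampledTop V₁ s (fun j => I j w))ᵀ)} := by
  classical
  have hV : V₁ᵀ * V₁ = 1 := by
    rw [hV₁]
    exact ColumnSampling.firstColumns_transpose_mul_self hSVD.right_orthonormal hkρ.le
  have hk0 : (0 : ℝ) < k := by exact_mod_cast hk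
  have hR := ColumnSampling.scoreRatio_pos hV hk hpos
  have hm : Measurable fun w j => I j w := measurable_pi_lambda _ hmeas
  -- The samples with a too small eigenvalue, a subset of the finite set of all samples.
  let B : Finset (Fin ℓ → Fin n) := {i | ∃ μ ∈ spectrum ℝ (∑ j, Matrix.vecMulVec
    (ColumnSampling.scaledRow V₁ s (i j)) (ColumnSampling.scaledRow V₁ s (i j))),
      μ < (1 - δ) * (ℓ * (1 / k : ℝ))}
  have hB : P.real ((fun w j => I j w) ⁻¹' (B : Set (Fin ℓ → Fin n))) ≤
      k * Real.exp (-(δ ^ 2 * ℓ / (2 * k * ColumnSampling.scoreRatio V₁ s))) := by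
    rw [ColumnSampling.measureReal_preimage_eq_sum_prod P hmeas hindep]
    simp only [hlaw, hsum]
    refine (ColumnSampling.sum_prod_filter_spectrum_lt_le
      (x := ColumnSampling.scaledRow V₁ s) (R := ColumnSampling.scoreRatio V₁ s)
      (fun i => div_nonneg (hs i) hk0.le) (by rw [← Finset.sum_div, hsum, div_self hk0.ne'])
      (fun i => ?_) (ColumnSampling.sum_smul_vecMulVec_scaledRow hV hs hpos) hR
      (by positivity) ℓ hδ).trans_eq ?_
    · rw [ColumnSampling.scaledRow_dotProduct_self V₁ hs]
      exact ColumnSampling.leverage_div_le_scoreRatio V₁ s i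
    · rw [Fintype.card_fin]
      congr 3
      field_simp
  have hmB : MeasurableSet ((fun w j => I j w) ⁻¹' (B : Set (Fin ℓ → Fin n))) :=
    hm B.measurableSet
  calc _ ≤ 1 - P.real ((fun w j => I j w) ⁻¹' (B : Set (Fin ℓ → Fin n))) :=
        sub_le_sub_left hB 1
    _ = P.real ((fun w j => I j w) ⁻¹' (B : Set (Fin ℓ → Fin n)))ᶜ :=
        (probReal_compl_eq_one_sub hmB).symm
    _ ≤ _ := measureReal_mono fun w hw => by
        by_contra hlt
        refine hw (Finset.mem_coe.2 (Finset.mem_filter.2 ⟨Finset.mem_univ _, ?_⟩))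
        rw [Set.mem_ofPred_eq, not_le] at hlt
        rw [← ColumnSampling.sampledTop_mul_transpose, mul_one_div]
        refine ColumnSampling.exists_mem_spectrum_lt ?_ hk hlt
        simp [Matrix.IsHermitian, Matrix.conjTranspose_eq_transpose_of_trivial,
          Matrix.transpose_mul]
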